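/- Let $(W,S)$ be an irreducible finite Coxeter system of rank $n=|S|\ge 2$ (irreducible: its Coxeter diagram is connected). Let $m(s,t)$ be the order of the product $st$ in $W$ and let $m=\max\{m(s,t) \mid s,t\in S\}$. Let $\Delta=\{\alpha_s \mid s\in S\}$ be the simple roots of the geometric representation of $W$, that is, the basis of $\mathbb{R}^S$ on which $s\in S$ acts as the reflection $v\mapsto v-2\langle\alpha_s,v\rangle\alpha_s$ for the bilinear form with $\langle\alpha_s,\alpha_t\rangle=-\cos(\pi/m(s,t))$; let $\Phi=W\Delta$ be the root system and $\Phi^-\subset\Phi$ the set of roots all of whose coordinates in the basis $\Delta$ are nonpositive. For $w\in W$ let $\operatorname{des}(w)=\#\{\beta\in\Delta \mid w(\beta)\in\Phi^-\}$ be the number of $W$-descents of $w$, and let $X_{\operatorname{des}}=\operatorname{des}(w)$ for $w\in W$ chosen uniformly at random. Then $$\mathbb{E}(X_{\operatorname{des}})=\frac n2,\qquad \mathbb{V}(X_{\operatorname{des}})=\frac{n-2}{12}+\frac1m .$$ -/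

import Mathlib

open Real MeasureTheory ProbabilityTheory

noncomputable section

namespace CoxeterMatrix

variable {B : Type*} (M : CoxeterMatrix B)

/-- The underlying graph of the Coxeter diagram: distinct vertices `i`, `j` are joined by an edge
unless `m(i, j) = 2`, that is, iff `m(i, j) ≥ 3` or `m(i, j) = ∞` (encoded as `0`). -/
def diagram : SimpleGraph B where
  Adj i j := i ≠ j ∧ M i j ≠ 2
  symm := ⟨fun i j h => ⟨h.1.symm, by rw [M.symmetric]; exact h.2⟩⟩
  loopless := ⟨fun _ h => h.1 rfl⟩

/-- A Coxeter system is irreducible if its Coxeter diagram is connected. -/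
def IsIrreducible : Prop := M.diagram.Connected

/-- The canonical bilinear form on the real vector space with basis `(α_i)_{i ∈ B}`, given by
`⟨α_i, α_j⟩ = - cos (π / m(i, j))` (so `-1` if `m(i, j) = ∞`, since `π / 0 = 0`). -/
def rootForm : LinearMap.BilinForm ℝ (B →₀ ℝ) :=
  Finsupp.linearCombination ℝ fun i =>
    Finsupp.linearCombination ℝ fun j => -Real.cos (π / (M i j : ℝ))

/-- The simple root `α_i`. -/
def simpleRoot (_M : CoxeterMatrix B) (i : B) : B →₀ ℝ := Finsupp.single i 1

theorem rootForm_simpleRoot (i j : B) :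
    M.rootForm (M.simpleRoot i) (M.simpleRoot j) = -Real.cos (π / (M i j : ℝ)) := by
  simp [rootForm, simpleRoot]

theorem two_smul_rootForm_self (i : B) :
    ((2 : ℝ) • M.rootForm (M.simpleRoot i)) (M.simpleRoot i) = 2 := by
  simp [rootForm_simpleRoot]

/-- The reflection `v ↦ v - 2 ⟨α_i, v⟩ α_i`. -/
def rootReflection (i : B) : (B →₀ ℝ) ≃ₗ[ℝ] (B →₀ ℝ) :=
  Module.reflection (M.two_smul_rootForm_self i)

theorem rootReflection_apply (i : B) (v : B →₀ ℝ) :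
    M.rootReflection i v = v - (2 * M.rootForm (M.simpleRoot i) v) • M.simpleRoot i := by
  simp [rootReflection, Module.reflection_apply]

/-- The reflections `v ↦ v - 2 ⟨α_i, v⟩ α_i` satisfy the Coxeter relations. -/
theorem isLiftable_rootReflection : M.IsLiftable M.rootReflection := by
  intro i j
  rcases eq_or_ne i j with rfl | hij
  · rw [M.diagonal, pow_one]
    ext1 v
    exact Module.involutive_reflection (M.two_smul_rootForm_self i) v
  have hfy : ((2 : ℝ) • M.rootForm (M.simpleRoot i)) (M.simpleRoot j)
      = -2 * Real.cos (π / (M i j : ℝ)) := by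
    simp [rootForm_simpleRoot]
  have hgx : ((2 : ℝ) • M.rootForm (M.simpleRoot j)) (M.simpleRoot i)
      = -2 * Real.cos (π / (M i j : ℝ)) := by
    simp [rootForm_simpleRoot, M.symmetric j i]
  have h1 := M.off_diagonal i j hij
  apply LinearEquiv.toLinearMap_injective
  refine (Module.reflection_mul_reflection_pow (M.two_smul_rootForm_self i)
    (M.two_smul_rootForm_self j) (M i j) (2 * Real.cos (2 * π / (M i j : ℝ))) ?_).trans ?_
  · rw [hfy, hgx, show 2 * π / (M i j : ℝ) = 2 * (π / (M i j : ℝ)) by ring, Real.cos_two_mul]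
    ring
  rw [hfy, hgx]
  generalize M i j = m at h1
  rcases Nat.lt_or_ge m 3 with hm | hm
  · interval_cases m
    · ext
      simp
    · exact absurd rfl h1
    · refine LinearMap.ext fun v => ?_
      simp
      module
  have hm0 : (0 : ℝ) < m := by positivity
  have hm3 : (3 : ℝ) ≤ m := by exact_mod_cast hm
  set θ : ℝ := 2 * π / (m : ℝ) with hθ
  have hmθ : (m : ℝ) * θ = 2 * π := by rw [hθ]; field_simp
  have hsin : Real.sin θ ≠ 0 := by
    refine (Real.sin_pos_of_pos_of_lt_pi (by positivity) ?_).ne'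
    rw [hθ, div_lt_iff₀ hm0]
    nlinarith [Real.pi_pos]
  have hS := Polynomial.Chebyshev.S_two_mul_real_cos θ
  have key : ∀ p : ℝ, p * Real.sin θ = 0 → p = 0 := fun p hp =>
    (mul_eq_zero.mp hp).resolve_right hsin
  rcases Nat.even_or_odd' m with ⟨k, hk | hk⟩
  · have e1 : ((m : ℤ) - 2) / 2 = k - 1 := by lia
    have e2 : ((m : ℤ) - 1) / 2 = k - 1 := by lia
    have z : (Polynomial.Chebyshev.S ℝ ((k : ℤ) - 1)).eval (2 * Real.cos θ) = 0 := by
      apply key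
      rw [hS]
      have : (k : ℝ) * θ = π := by rw [hk] at hmθ; push_cast at hmθ; linarith
      push_cast
      rw [sub_add_cancel, this, Real.sin_pi]
    rw [e1, e2, z]
    simp
  · have e1 : ((m : ℤ) - 2) / 2 = k - 1 := by lia
    have e2 : ((m : ℤ) - 1) / 2 = k := by lia
    have e3 : ((m : ℤ) - 3) / 2 = k - 1 := by lia
    have e4 : (m : ℤ) / 2 = k := by lia
    have z : (Polynomial.Chebyshev.S ℝ (k : ℤ)).eval (2 * Real.cos θ)
        + (Polynomial.Chebyshev.S ℝ ((k : ℤ) - 1)).eval (2 * Real.cos θ) = 0 := by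
      apply key
      rw [add_mul, hS, hS]
      have : ((k : ℝ) + 1) * θ = 2 * π - k * θ := by
        rw [hk] at hmθ; push_cast at hmθ; linarith
      push_cast
      rw [sub_add_cancel, this, Real.sin_two_pi_sub]
      ring
    rw [e1, e2, e3, e4, z]
    simp

/-- The set `Δ` of simple roots. -/
def simpleRoots : Set (B →₀ ℝ) := Set.range M.simpleRoot

end CoxeterMatrix

namespace CoxeterSystem

variable {B : Type*} {M : CoxeterMatrix B} {W : Type*} [Group W] (cs : CoxeterSystem M W)

/-- The geometric representation of `W`: the simple reflection `s_i` acts as the reflection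
`v ↦ v - 2 ⟨α_i, v⟩ α_i`. -/
def geomRep : W →* ((B →₀ ℝ) ≃ₗ[ℝ] (B →₀ ℝ)) :=
  cs.lift ⟨M.rootReflection, M.isLiftable_rootReflection⟩

theorem geomRep_simple (i : B) : cs.geomRep (cs.simple i) = M.rootReflection i :=
  cs.lift_apply_simple M.isLiftable_rootReflection i

/-- The root system `Φ = {w(α) | w ∈ W, α ∈ Δ}`. -/
def roots : Set (B →₀ ℝ) := {β | ∃ w : W, ∃ α ∈ M.simpleRoots, β = cs.geomRep w α}

/-- The set `Φ⁻` of negative roots: the roots all of whose coordinates with respect to the simple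
roots are nonpositive. -/
def negativeRoots : Set (B →₀ ℝ) := {β ∈ cs.roots | ∀ i, β i ≤ 0}

/-- The set `Des(w) = {β ∈ Δ | w(β) ∈ Φ⁻}` of `W`-descents of `w`. -/
def descents (w : W) : Set (B →₀ ℝ) := {β ∈ M.simpleRoots | cs.geomRep w β ∈ cs.negativeRoots}

/-- The number `des(w)` of `W`-descents of `w`. -/
def des (w : W) : ℕ := (cs.descents w).ncard

/-- The maximum over `s, t ∈ S` of the order `m(s, t)` of the product `s t` in `W`. -/
def mMax [Fintype B] : ℕ :=
  Finset.univ.sup fun p : B × B => orderOf (cs.simple p.1 * cs.simple p.2)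

end CoxeterSystem

end

/-! The number of descents is a sum of indicators of right descents, because `w` makes a simple root
negative exactly when the matching simple reflection shortens `w` on the right
(`isRightDescent_iff_geomRep_nonpos`). Right multiplication by `s_i` toggles the descent at `i`, so
each indicator has mean 1/2.

For a pair `i ≠ j`, every element factors uniquely as `d * p` with `d` having no descent at `i` or
`j` and `p` in a dihedral group of order `2 m(i,j)` (`isComplement_dihedral`). So both indicators
vanish with probability `1/(2 m(i,j))`, and since the means are 1/2 both equal one with the same
probability. The second moment is therefore the sum of `1/(2 m(i,j))` over all ordered pairs.

Finiteness enters through averaging: the root form is positive definite (`rootForm_pos_of_finite`).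
This forces the diagram to be a tree with at most one label other than 3, so the sum depends only on
`n` and `m`; no classification is needed. -/

namespace CoxeterMatrix

variable {B : Type*} (M : CoxeterMatrix B)

/-! ### Diagrams with positive definite root form -/

theorem rootForm_comm (u v : B →₀ ℝ) : M.rootForm u v = M.rootForm v u := by
  have h : M.rootForm = M.rootForm.flip := by
    ext i j
    have := M.rootForm_simpleRoot i j
    have h2 := M.rootForm_simpleRoot j i
    rw [M.symmetric j i] at h2
    simp only [simpleRoot] at this h2
    simp [this, h2]
  conv_lhs => rw [h]
  rfl

theorem rootForm_simpleRoot_self (i : B) :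
    M.rootForm (M.simpleRoot i) (M.simpleRoot i) = 1 := by
  simp [rootForm_simpleRoot]

theorem rootForm_simpleRoot_nonpos {i j : B} (h : i ≠ j) :
    M.rootForm (M.simpleRoot i) (M.simpleRoot j) ≤ 0 := by
  rw [rootForm_simpleRoot, neg_nonpos]
  have h1 := M.off_diagonal i j h
  apply Real.cos_nonneg_of_neg_pi_div_two_le_of_le
  · have : 0 ≤ π / (M i j : ℝ) := by positivity
    linarith [Real.pi_pos]
  · rcases Nat.eq_zero_or_pos (M i j) with h0 | h0
    · simp [h0]; positivity
    · apply div_le_div_of_nonneg_left Real.pi_pos.le (by norm_num)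
      exact_mod_cast (by omega : 2 ≤ M i j)

theorem rootForm_simpleRoot_le_neg_half {i j : B} (h : M.diagram.Adj i j) :
    M.rootForm (M.simpleRoot i) (M.simpleRoot j) ≤ -(1 / 2) := by
  rw [rootForm_simpleRoot, neg_le_neg_iff, ← Real.cos_pi_div_three]
  have h1 := M.off_diagonal i j h.1
  have h2 := h.2
  rcases Nat.eq_zero_or_pos (M i j) with h0 | h0
  · simp only [h0, Nat.cast_zero, div_zero, Real.cos_zero]; exact Real.cos_le_one _
  · apply Real.cos_le_cos_of_nonneg_of_le_pi (by positivity) (by linarith [Real.pi_pos])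
    apply div_le_div_of_nonneg_left Real.pi_pos.le (by norm_num)
    exact_mod_cast (by omega : 3 ≤ M i j)

theorem rootForm_simpleRoot_le_neg_sqrt_two {i j : B} (h : M.diagram.Adj i j) (h3 : M i j ≠ 3) :
    M.rootForm (M.simpleRoot i) (M.simpleRoot j) ≤ -(√2 / 2) := by
  rw [rootForm_simpleRoot, neg_le_neg_iff, ← Real.cos_pi_div_four]
  have h1 := M.off_diagonal i j h.1
  have h2 := h.2
  rcases Nat.eq_zero_or_pos (M i j) with h0 | h0
  · simp only [h0, Nat.cast_zero, div_zero, Real.cos_zero]; exact Real.cos_le_one _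
  · apply Real.cos_le_cos_of_nonneg_of_le_pi (by positivity) (by linarith [Real.pi_pos])
    apply div_le_div_of_nonneg_left Real.pi_pos.le (by norm_num)
    exact_mod_cast (by omega : 4 ≤ M i j)

theorem rootReflection_simpleRoot_self (i : B) :
    M.rootReflection i (M.simpleRoot i) = -M.simpleRoot i := by
  rw [rootReflection_apply, rootForm_simpleRoot_self]; module

theorem rootReflection_simpleRoot (i j : B) :
    M.rootReflection i (M.simpleRoot j)
      = M.simpleRoot j + (2 * Real.cos (π / (M i j : ℝ))) • M.simpleRoot i := by
  rw [rootReflection_apply, rootForm_simpleRoot]; module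

/-- The sum of the simple roots along a path of the Coxeter diagram. -/
noncomputable def pathSum {u v : B} (p : M.diagram.Walk u v) : B →₀ ℝ :=
  (p.support.map M.simpleRoot).sum

theorem rootForm_pathSum_nonpos {u v x : B} (p : M.diagram.Walk u v) (hx : x ∉ p.support) :
    M.rootForm (M.simpleRoot x) (M.pathSum p) ≤ 0 := by
  rw [pathSum, map_list_sum, List.map_map]
  refine List.sum_le_card_nsmul _ 0 (fun y hy => ?_) |>.trans_eq (smul_zero _)
  simp only [List.mem_map, Function.comp] at hy
  obtain ⟨z, hz, rfl⟩ := hy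
  exact M.rootForm_simpleRoot_nonpos (by rintro rfl; exact hx hz)

theorem pathSum_cons {u v w : B} (h : M.diagram.Adj u v) (p : M.diagram.Walk v w) :
    M.pathSum (.cons h p) = M.simpleRoot u + M.pathSum p := by
  simp [pathSum]

theorem rootForm_pathSum_le_start {u v x : B} (p : M.diagram.Walk u v) (hx : x ∉ p.support) :
    M.rootForm (M.simpleRoot x) (M.pathSum p) ≤
      M.rootForm (M.simpleRoot x) (M.simpleRoot u) := by
  cases p with
  | nil => simp [pathSum]
  | cons h q =>
    rw [pathSum_cons, map_add]
    have := M.rootForm_pathSum_nonpos q (x := x) (by simp at hx; tauto)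
    linarith

theorem rootForm_pathSum_le_end {u v x : B} (p : M.diagram.Walk u v) (hx : x ∉ p.support) :
    M.rootForm (M.simpleRoot x) (M.pathSum p) ≤
      M.rootForm (M.simpleRoot x) (M.simpleRoot v) := by
  have := M.rootForm_pathSum_le_start p.reverse (x := x) (by simpa using hx)
  simpa [pathSum] using this

/-- Prepending a vertex adds 1 for its own root and twice a cross term that is at most -1/2. -/
theorem rootForm_pathSum_self_le_one {u v : B} (p : M.diagram.Walk u v) (hp : p.IsPath) :
    M.rootForm (M.pathSum p) (M.pathSum p) ≤ 1 := by
  induction p with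
  | nil => simp [pathSum, rootForm_simpleRoot_self]
  | cons h q ih =>
    rw [SimpleGraph.Walk.cons_isPath_iff] at hp
    have h1 := M.rootForm_pathSum_le_start q hp.2
    have h2 := M.rootForm_simpleRoot_le_neg_half h
    have h3 := ih hp.1
    rw [pathSum_cons]
    simp only [map_add, LinearMap.add_apply, rootForm_simpleRoot_self]
    rw [M.rootForm_comm (M.pathSum q)]
    linarith

theorem pathSum_ne_zero {u v : B} (p : M.diagram.Walk u v) : M.pathSum p u ≠ 0 := by
  have : 0 < M.pathSum p u := by
    cases p with
    | nil => simp [pathSum, simpleRoot]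
    | cons h q =>
      rw [pathSum_cons]
      have : 0 ≤ M.pathSum q u := by
        rw [pathSum, ← Finsupp.applyAddHom_apply, map_list_sum, List.map_map]
        apply List.sum_nonneg
        intro y hy
        simp only [List.mem_map, Function.comp] at hy
        obtain ⟨z, hz, rfl⟩ := hy
        simp only [simpleRoot, Finsupp.applyAddHom_apply]
        classical
        rw [Finsupp.single_apply]; split_ifs <;> simp
      simp only [simpleRoot, Finsupp.add_apply, Finsupp.single_eq_same]; linarith
  exact this.ne'

variable {M}

/-- If the root form is positive definite, at most one edge of a connected Coxeter diagram has a
label other than `3`. -/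
theorem edge_unique_of_posDef (hirr : M.IsIrreducible)
    (hpos : ∀ v, v ≠ 0 → 0 < M.rootForm v v) {a b c d : B}
    (hab : M.diagram.Adj a b) (hab3 : M a b ≠ 3) (hcd : M.diagram.Adj c d) (hcd3 : M c d ≠ 3) :
    s(a, b) = s(c, d) := by
  by_contra hne
  -- Among the offending pairs of oriented edges, take one with `b` and `c` closest; a shortest path
  -- from `b` to `c` then avoids `a` and `d`.
  obtain ⟨⟨⟨a, b⟩, ⟨c, d⟩⟩, hS, hmin⟩ :=
    (measure fun q : (B × B) × (B × B) => M.diagram.dist q.1.2 q.2.1).wf.has_min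
      {q | (M.diagram.Adj q.1.1 q.1.2 ∧ M q.1.1 q.1.2 ≠ 3) ∧
        (M.diagram.Adj q.2.1 q.2.2 ∧ M q.2.1 q.2.2 ≠ 3) ∧ s(q.1.1, q.1.2) ≠ s(q.2.1, q.2.2)}
      ⟨((a, b), (c, d)), ⟨hab, hab3⟩, ⟨hcd, hcd3⟩, hne⟩
  clear hne hab3 hab hcd hcd3
  obtain ⟨⟨hab, hab3⟩, ⟨hcd, hcd3⟩, hne⟩ := hS
  simp only at hab hab3 hcd hcd3 hne
  have hmin1 : M.diagram.dist b c ≤ M.diagram.dist a c := by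
    have := hmin ((b, a), (c, d)) ⟨⟨hab.symm, by rwa [M.symmetric] at hab3⟩, ⟨hcd, hcd3⟩,
      by rwa [Sym2.eq_swap (a := b)]⟩
    simpa [WellFoundedRelation.rel, measure, invImage, InvImage] using this
  have hmin2 : M.diagram.dist b c ≤ M.diagram.dist b d := by
    have := hmin ((a, b), (d, c)) ⟨⟨hab, hab3⟩, ⟨hcd.symm, by rwa [M.symmetric] at hcd3⟩,
      by rwa [Sym2.eq_swap (a := d)]⟩
    simpa [WellFoundedRelation.rel, measure, invImage, InvImage] using this
  have hmin3 : M.diagram.dist b c ≤ M.diagram.dist a d := by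
    have := hmin ((b, a), (d, c)) ⟨⟨hab.symm, by rwa [M.symmetric] at hab3⟩,
      ⟨hcd.symm, by rwa [M.symmetric] at hcd3⟩,
      by rwa [Sym2.eq_swap (a := d), Sym2.eq_swap (a := b)]⟩
    simpa [WellFoundedRelation.rel, measure, invImage, InvImage] using this
  have hconn : M.diagram.Connected := hirr
  classical
  obtain ⟨p, hp, hpl⟩ := hconn.exists_path_of_dist b c
  have hap : a ∉ p.support := by
    intro h
    have e := congrArg SimpleGraph.Walk.length (p.take_spec h)
    rw [SimpleGraph.Walk.length_append] at e
    have h1 := SimpleGraph.dist_le (p.dropUntil a h)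
    have h2 : (p.takeUntil a h).length ≠ 0 := fun h0 =>
      hab.ne (SimpleGraph.Walk.eq_of_length_eq_zero h0).symm
    omega
  have hdp : d ∉ p.support := by
    intro h
    have e := congrArg SimpleGraph.Walk.length (p.take_spec h)
    rw [SimpleGraph.Walk.length_append] at e
    have h1 := SimpleGraph.dist_le (p.takeUntil d h)
    have h2 : (p.dropUntil d h).length ≠ 0 := fun h0 =>
      hcd.ne (SimpleGraph.Walk.eq_of_length_eq_zero h0).symm
    omega
  have had : a ≠ d := by
    rintro rfl
    rw [SimpleGraph.dist_self, nonpos_iff_eq_zero, hconn.dist_eq_zero_iff] at hmin3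
    subst hmin3
    exact hne Sym2.eq_swap
  -- The form on this vector is at most 1 + 1 + 2 - 2 - 2 = 0: with weight √2 on the path, each end
  -- edge contributes at most `2 * √2 * (-√2/2)`.
  have key := hpos (M.simpleRoot a + M.simpleRoot d + √2 • M.pathSum p) (by
    intro h0
    have := DFunLike.congr_fun h0 b
    have hb := M.pathSum_ne_zero p
    have hb' : b ≠ d := fun h => hdp (h ▸ p.start_mem_support)
    simp [simpleRoot, hab.ne, hb'.symm] at this
    exact hb this)
  have h1 := M.rootForm_pathSum_self_le_one p hp
  have h2 := (M.rootForm_pathSum_le_start p hap).trans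
    (M.rootForm_simpleRoot_le_neg_sqrt_two hab hab3)
  have h3 := (M.rootForm_pathSum_le_end p hdp).trans
    ((M.rootForm_comm _ _).trans_le (M.rootForm_simpleRoot_le_neg_sqrt_two hcd hcd3))
  have h4 := M.rootForm_simpleRoot_nonpos had
  simp only [map_add, LinearMap.add_apply, rootForm_simpleRoot_self, map_smul, smul_eq_mul,
    LinearMap.smul_apply] at key
  rw [M.rootForm_comm (M.pathSum p) (M.simpleRoot a), M.rootForm_comm (M.pathSum p)
    (M.simpleRoot d), M.rootForm_comm (M.simpleRoot d) (M.simpleRoot a)] at key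
  have hs : √2 * √2 = 2 := Real.mul_self_sqrt (by norm_num)
  have hs0 : 0 ≤ √2 := Real.sqrt_nonneg 2
  have h5 := mul_le_mul_of_nonneg_left h2 hs0
  have h6 := mul_le_mul_of_nonneg_left h3 hs0
  have h7 : √2 * (√2 * M.rootForm (M.pathSum p) (M.pathSum p)) ≤ 2 := by
    rw [← mul_assoc, hs]; linarith
  nlinarith

/-- If the root form is positive definite, the Coxeter diagram has fewer edges than vertices. -/
theorem sum_adj_lt_of_posDef [Fintype B] [Nonempty B]
    (hpos : ∀ v, v ≠ 0 → 0 < M.rootForm v v) [DecidableRel M.diagram.Adj] :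
    ∑ i, M.diagram.degree i < 2 * Fintype.card B := by
  classical
  -- On the sum of all simple roots the form is at most `n` minus half the degree sum.
  have hne : (∑ i, M.simpleRoot i) ≠ 0 := by
    intro h0
    obtain ⟨b⟩ := ‹Nonempty B›
    have := DFunLike.congr_fun h0 b
    simp [simpleRoot, Finsupp.finsetSum_apply, Finsupp.single_apply] at this
  have key := hpos _ hne
  simp only [map_sum, LinearMap.sum_apply] at key
  have hb : ∀ i j, M.rootForm (M.simpleRoot j) (M.simpleRoot i) ≤
      (if i = j then 1 else 0) - (1 / 2) * (if M.diagram.Adj i j then 1 else 0) := by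
    intro i j
    split_ifs with h1 h2 h2
    · exact absurd h1 h2.ne
    · subst h1; rw [rootForm_simpleRoot_self]; norm_num
    · linarith [M.rootForm_simpleRoot_le_neg_half h2.symm]
    · linarith [M.rootForm_simpleRoot_nonpos (Ne.symm h1)]
  have := key.trans_le (Finset.sum_le_sum fun i _ => Finset.sum_le_sum fun j _ => hb i j)
  have hdeg : ∀ i, (∑ j, if M.diagram.Adj i j then (1 : ℝ) else 0) = M.diagram.degree i := by
    intro i
    rw [Finset.sum_boole, ← SimpleGraph.card_neighborFinset_eq_degree,
      SimpleGraph.neighborFinset_eq_filter]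
  simp only [Finset.sum_sub_distrib, ← Finset.mul_sum, hdeg, Finset.sum_ite_eq, Finset.mem_univ,
    if_true, Finset.sum_const, Finset.card_univ, nsmul_eq_mul, mul_one] at this
  have h : (∑ i, M.diagram.degree i : ℝ) < 2 * Fintype.card B := by linarith
  exact_mod_cast h

/-- An infinite label gives form value -1, which would make `α_i + α_j` isotropic. -/
theorem ne_zero_of_posDef (hpos : ∀ v, v ≠ 0 → 0 < M.rootForm v v) (i j : B) : M i j ≠ 0 := by
  intro h0
  have hij : i ≠ j := by rintro rfl; simp at h0
  have key := hpos (M.simpleRoot i + M.simpleRoot j) (by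
    intro h
    have := DFunLike.congr_fun h i
    simp [simpleRoot, hij.symm] at this)
  simp only [map_add, LinearMap.add_apply, rootForm_simpleRoot, M.symmetric j i, h0] at key
  simp at key

end CoxeterMatrix

/-! ### Positive definiteness by averaging over the group -/

namespace CoxeterSystem

variable {B : Type*} {M : CoxeterMatrix B} {W : Type*} [Group W]

/-- The root form of an irreducible finite Coxeter group is positive definite. -/
theorem rootForm_pos_of_finite (cs : CoxeterSystem M W) [Fintype B] [Finite W]
    (hirr : M.IsIrreducible) (v : B →₀ ℝ)
    (hv : v ≠ 0) : 0 < M.rootForm v v := by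
  classical
  cases nonempty_fintype W
  set Q : (B →₀ ℝ) → (B →₀ ℝ) → ℝ := fun u v =>
    -- The standard inner product summed over the group: positive definite and invariant. It turns
    -- out to be a positive multiple of the root form.
    ∑ w : W, ∑ b, cs.geomRep w u b * cs.geomRep w v b with hQ
  have hsymm : ∀ u v, Q u v = Q v u := fun u v => by simp only [hQ, mul_comm]
  have hadd : ∀ u v x, Q u (v + x) = Q u v + Q u x := fun u v x => by
    simp only [hQ, map_add, Finsupp.add_apply, mul_add, Finset.sum_add_distrib]
  have hsmul : ∀ u v (c : ℝ), Q u (c • v) = c * Q u v := fun u v c => by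
    simp only [hQ, map_smul, Finsupp.smul_apply, smul_eq_mul, Finset.mul_sum]
    exact Finset.sum_congr rfl fun w _ => Finset.sum_congr rfl fun b _ => by ring
  have hpos : ∀ u, u ≠ 0 → 0 < Q u u := by
    intro u hu
    refine Finset.sum_pos' (fun w _ => Finset.sum_nonneg fun b _ => mul_self_nonneg _)
      ⟨1, Finset.mem_univ _, ?_⟩
    obtain ⟨b, hb⟩ := Finsupp.ne_iff.mp hu
    refine Finset.sum_pos' (fun b _ => mul_self_nonneg _) ⟨b, Finset.mem_univ _, ?_⟩
    simp only [map_one, LinearEquiv.coe_one, id_eq]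
    exact mul_self_pos.mpr (by simpa using hb)
  have hinv : ∀ i u v, Q (M.rootReflection i u) (M.rootReflection i v) = Q u v := by
    intro i u v
    simp only [hQ, ← cs.geomRep_simple, ← LinearEquiv.mul_apply, ← map_mul]
    exact Equiv.sum_comp (Equiv.mulRight (cs.simple i))
      (fun w => ∑ b, cs.geomRep w u b * cs.geomRep w v b)
  have hα : ∀ i, M.simpleRoot i ≠ 0 := fun i => by simp [CoxeterMatrix.simpleRoot]
  have hrel : ∀ i u, Q u (M.simpleRoot i)
      = M.rootForm (M.simpleRoot i) u * Q (M.simpleRoot i) (M.simpleRoot i) := by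
    intro i u
    have h := hinv i u (M.simpleRoot i)
    rw [M.rootReflection_simpleRoot_self, M.rootReflection_apply, sub_eq_add_neg, ← neg_smul,
      ← neg_one_smul ℝ (M.simpleRoot i), hsmul, hsymm _ (M.simpleRoot i), hadd,
      hsmul, hsymm _ u] at h
    linarith
  -- On an edge, the symmetry of `Q` and `hrel` compare the two norms through the same nonzero form
  -- value; connectedness propagates equality.
  have hconst : ∀ i j, Q (M.simpleRoot i) (M.simpleRoot i) = Q (M.simpleRoot j) (M.simpleRoot j) := by
    intro i j
    have hconn : M.diagram.Connected := hirr
    obtain ⟨p⟩ := hconn i j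
    induction p with
    | nil => rfl
    | cons h q ih =>
      rename_i x y z
      rw [← ih]
      have h1 := hrel x (M.simpleRoot y)
      rw [hsymm, hrel y, M.rootForm_comm] at h1
      have h2 := M.rootForm_simpleRoot_le_neg_half h
      exact (mul_left_cancel₀ (by linarith) h1).symm
  obtain ⟨b⟩ := (hirr : M.diagram.Connected).nonempty
  have hall : Q v v = Q (M.simpleRoot b) (M.simpleRoot b) * M.rootForm v v := by
    suffices h : ∀ u, Q v u = Q (M.simpleRoot b) (M.simpleRoot b) * M.rootForm u v from h v
    intro u
    induction u using Finsupp.induction_linear with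
    | zero => simp [hQ]
    | add x y hx hy => rw [hadd, hx, hy, map_add, LinearMap.add_apply, mul_add]
    | single i c =>
      have : Finsupp.single i c = c • M.simpleRoot i := by simp [CoxeterMatrix.simpleRoot]
      rw [this, hsmul, hrel, hconst i b, map_smul, LinearMap.smul_apply, smul_eq_mul]
      ring
  have h1 := hpos v hv
  rw [hall] at h1
  exact pos_of_mul_pos_right h1 (hpos _ (hα b)).le

end CoxeterSystem

/-! ### Descents and signs of roots -/

namespace CoxeterSystem

variable {B : Type*} {M : CoxeterMatrix B} {W : Type*} [Group W] (cs : CoxeterSystem M W)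

/-- The product of the alternating word of length `k` in `i` and `j` ending with `j`. -/
def alternatingProd (i j : B) (k : ℕ) : W := cs.wordProd (alternatingWord i j k)

@[simp]
theorem alternatingProd_zero (i j : B) : cs.alternatingProd i j 0 = 1 := by
  simp [alternatingProd, alternatingWord]

theorem alternatingProd_succ (i j : B) (k : ℕ) :
    cs.alternatingProd i j (k + 1) = cs.alternatingProd j i k * cs.simple j := by
  rw [alternatingProd, alternatingWord_succ, wordProd_concat, alternatingProd]

theorem alternatingProd_succ' (i j : B) (k : ℕ) :
    cs.alternatingProd i j (k + 1) =
      cs.simple (if Even k then j else i) * cs.alternatingProd i j k := by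
  rw [alternatingProd, alternatingWord_succ', wordProd_cons, alternatingProd]

theorem alternatingProd_add (i j : B) (k l : ℕ) :
    cs.alternatingProd i j (k + l) =
      (if Even l then cs.alternatingProd i j k else cs.alternatingProd j i k) *
        cs.alternatingProd i j l := by
  induction k with
  | zero => simp
  | succ k ih =>
    rw [Nat.add_right_comm, alternatingProd_succ', ih]
    by_cases hl : Even l <;> by_cases hk : Even k <;>
      simp [hl, hk, Nat.even_add, alternatingProd_succ', mul_assoc]

theorem alternatingProd_eq_sub (i j : B) {k : ℕ} (hk : k ≤ 2 * M i j) :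
    cs.alternatingProd i j k = cs.alternatingProd j i (2 * M i j - k) := by
  rw [alternatingProd, cs.prod_alternatingWord_eq_prod_alternatingWord_sub i j k (by omega),
    mul_comm, alternatingProd]

theorem length_alternatingProd_le (i j : B) (k : ℕ) :
    cs.length (cs.alternatingProd i j k) ≤ k :=
  (cs.length_wordProd_le _).trans_eq (length_alternatingWord i j k)

/-- The action of the dihedral parabolic subgroups on their simple roots. -/
theorem geomRep_alternatingProd {i j : B} (k : ℕ) :
    Real.sin (π / (M i j : ℝ)) • cs.geomRep (cs.alternatingProd i j k) (M.simpleRoot i) =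
      if Even k then
        Real.sin ((k + 1) * (π / (M i j : ℝ))) • M.simpleRoot i +
          Real.sin (k * (π / (M i j : ℝ))) • M.simpleRoot j
      else
        Real.sin (k * (π / (M i j : ℝ))) • M.simpleRoot i +
          Real.sin ((k + 1) * (π / (M i j : ℝ))) • M.simpleRoot j := by
  set θ := π / (M i j : ℝ) with hθ
  -- The three-term sine recurrence drives the induction on `k`.
  have htrig : ∀ x : ℝ, 2 * Real.cos θ * Real.sin ((x + 1) * θ) =
      Real.sin ((x + 2) * θ) + Real.sin (x * θ) := by
    intro x
    rw [show (x + 2) * θ = (x + 1) * θ + θ by ring, show x * θ = (x + 1) * θ - θ by ring,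
      Real.sin_add, Real.sin_sub]
    ring
  induction k with
  | zero => simp
  | succ k ih =>
    have e : Real.sin ((k + 1 + 1) * θ) = 2 * Real.cos θ * Real.sin ((k + 1) * θ)
        - Real.sin (k * θ) := by
      rw [htrig]; ring_nf
    rw [alternatingProd_succ', map_mul, LinearEquiv.mul_apply, geomRep_simple, ← map_smul, ih]
    by_cases hk : Even k
    · rw [if_pos hk, if_pos hk, if_neg (by simpa [Nat.even_add_one] using hk)]
      rw [map_add, map_smul, map_smul, M.rootReflection_simpleRoot_self,
        M.rootReflection_simpleRoot, M.symmetric j i, ← hθ]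
      push_cast
      rw [e]
      module
    · rw [if_neg hk, if_neg hk, if_pos (by simpa [Nat.even_add_one] using hk)]
      rw [map_add, map_smul, map_smul, M.rootReflection_simpleRoot_self,
        M.rootReflection_simpleRoot, ← hθ]
      push_cast
      rw [e]
      module

/-- For `k < m` the angles `kπ/m` and `(k+1)π/m` lie in `[0, π]`, so both sines are nonnegative. -/
theorem exists_geomRep_alternatingProd {i j : B} (hij : i ≠ j) (hM : M i j ≠ 0) {k : ℕ}
    (hk : k < M i j) :
    ∃ a b : ℝ, 0 ≤ a ∧ 0 ≤ b ∧ cs.geomRep (cs.alternatingProd i j k) (M.simpleRoot i) =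
      a • M.simpleRoot i + b • M.simpleRoot j := by
  have h2 : 2 ≤ M i j := by have := M.off_diagonal i j hij; omega
  have h2' : (2 : ℝ) ≤ M i j := by exact_mod_cast h2
  have hsin : 0 < Real.sin (π / (M i j : ℝ)) := by
    apply Real.sin_pos_of_pos_of_lt_pi (by positivity)
    rw [div_lt_iff₀ (by linarith)]
    nlinarith [Real.pi_pos]
  have hnn : ∀ x : ℝ, 0 ≤ x → x ≤ M i j → 0 ≤ Real.sin (x * (π / (M i j : ℝ))) := by
    intro x hx hxM
    apply Real.sin_nonneg_of_nonneg_of_le_pi (by positivity)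
    rw [mul_div_assoc', div_le_iff₀ (by linarith)]
    nlinarith [Real.pi_pos]
  have hk' : (k : ℝ) + 1 ≤ M i j := by exact_mod_cast hk
  have h0 := hnn k (by positivity) (by linarith)
  have h1 := hnn (k + 1) (by positivity) hk'
  have h := congrArg (fun v => (Real.sin (π / (M i j : ℝ)))⁻¹ • v)
    (cs.geomRep_alternatingProd (i := i) (j := j) k)
  simp only [smul_smul, inv_mul_cancel₀ hsin.ne', one_smul] at h
  split_ifs at h with hk
  · exact ⟨_, _, mul_nonneg (inv_nonneg.mpr hsin.le) h1, mul_nonneg (inv_nonneg.mpr hsin.le) h0,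
      by rw [h, smul_add, smul_smul, smul_smul]⟩
  · exact ⟨_, _, mul_nonneg (inv_nonneg.mpr hsin.le) h0, mul_nonneg (inv_nonneg.mpr hsin.le) h1,
      by rw [h, smul_add, smul_smul, smul_smul]⟩

/-- If `i` is not a right descent of `w`, then `w` sends the simple root `α_i` to a nonnegative
combination of simple roots. -/
theorem geomRep_simpleRoot_nonneg (hM : ∀ i j, M i j ≠ 0) (w : W) (i : B)
    (hw : ¬ cs.IsRightDescent w i) (b : B) : 0 ≤ cs.geomRep w (M.simpleRoot i) b := by
  induction hn : cs.length w using Nat.strong_induction_on generalizing w i with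
  | _ n ih =>
  subst hn
  by_cases hw1 : w = 1
  · subst hw1
    classical
    simp only [map_one, LinearEquiv.coe_one, id_eq, CoxeterMatrix.simpleRoot,
      Finsupp.single_apply]
    split_ifs <;> simp
  obtain ⟨j, hj⟩ := cs.exists_rightDescent_of_ne_one hw1
  have hij : i ≠ j := by rintro rfl; exact hw hj
  rw [cs.isRightDescent_iff] at hj
  rw [cs.not_isRightDescent_iff] at hw
  have hM0 := hM i j
  have h2 : 2 ≤ M i j := by have := M.off_diagonal i j hij; omega
  -- `P k`: the alternating word of length `k` ending in `j` splits off `w` on the right with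
  -- lengths adding. For the largest such `k`, the remaining factor has neither descent, and
  -- induction applies to it.
  let P : ℕ → Prop := fun k => ∃ v, w = v * cs.alternatingProd i j k ∧
    cs.length v + k = cs.length w
  have hP1 : P 1 := ⟨w * cs.simple j, by simp [alternatingProd_succ], hj⟩
  have hPpred : ∀ k, P (k + 1) → P k := by
    rintro k ⟨v, hv, hl⟩
    refine ⟨v * cs.simple (if Even k then j else i), ?_, ?_⟩
    · rw [hv, alternatingProd_succ', mul_assoc]
    · have h1 := cs.length_mul_le (v * cs.simple (if Even k then j else i))
        (cs.alternatingProd i j k)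
      rw [mul_assoc, ← alternatingProd_succ', ← hv] at h1
      have h3 := cs.length_alternatingProd_le i j k
      rcases cs.length_mul_simple v (if Even k then j else i) with h4 | h4 <;> omega
  have hPle : ∀ k, P k → k + 1 ≤ M i j := by
    -- By the braid relation a full word of length `m` can also be written ending in `i`, which
    -- would make `i` a descent of `w`.
    have hlt : ¬ P (M i j) := by
      rintro ⟨v, hv, hl⟩
      have h3 : w * cs.simple i = v * cs.alternatingProd i j (M i j - 1) := by
        rw [hv, cs.alternatingProd_eq_sub i j (by omega), mul_assoc,
          show 2 * M i j - M i j = (M i j - 1) + 1 by omega, alternatingProd_succ]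
        simp
      have h4 := cs.length_mul_le v (cs.alternatingProd i j (M i j - 1))
      have h5 := cs.length_alternatingProd_le i j (M i j - 1)
      rw [← h3] at h4
      omega
    intro k hk
    by_contra hlt'
    refine hlt (Nat.decreasingInduction' (P := P) (fun k _ _ h => hPpred k h)
      (by omega : M i j ≤ k) hk)
  obtain ⟨k, hk, hkmax⟩ : ∃ k, P k ∧ ∀ l, P l → l ≤ k := by
    classical
    refine ⟨Nat.findGreatest P (M i j), Nat.findGreatest_spec (by omega) hP1, fun l hl => ?_⟩
    exact Nat.le_findGreatest (by have := hPle l hl; omega) hl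
  have hk1 := hkmax 1 hP1
  have hkM := hPle k hk
  obtain ⟨v, hv, hl⟩ := hk
  have hnext : ¬ cs.IsRightDescent v (if Even k then j else i) := by
    intro hd
    rw [cs.isRightDescent_iff] at hd
    have := hkmax (k + 1) ⟨v * cs.simple (if Even k then j else i), by
      rw [alternatingProd_succ', mul_assoc, cs.simple_mul_simple_cancel_left, hv], by omega⟩
    omega
  -- A descent here would cancel against the first letter of the word and make `w` too short.
  have hprev : ¬ cs.IsRightDescent v (if Even k then i else j) := by
    intro hd
    rw [cs.isRightDescent_iff] at hd
    obtain ⟨l, rfl⟩ := Nat.exists_eq_add_of_le' hk1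
    have h3 : w = v * cs.simple (if Even (l + 1) then i else j) * cs.alternatingProd i j l := by
      rw [hv, alternatingProd_succ', mul_assoc]
      by_cases hl : Even l <;> simp [hl, Nat.even_add_one]
    have h4 := cs.length_mul_le (v * cs.simple (if Even (l + 1) then i else j))
      (cs.alternatingProd i j l)
    rw [← h3] at h4
    have h5 := cs.length_alternatingProd_le i j l
    omega
  have hvi : ¬ cs.IsRightDescent v i := by split_ifs at hnext hprev <;> assumption
  have hvj : ¬ cs.IsRightDescent v j := by split_ifs at hnext hprev <;> assumption
  have hi := ih (cs.length v) (by omega) v i hvi rfl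
  have hj' := ih (cs.length v) (by omega) v j hvj rfl
  obtain ⟨x, y, hx, hy, hxy⟩ := cs.exists_geomRep_alternatingProd hij hM0 hkM
  rw [hv, map_mul, LinearEquiv.mul_apply, hxy, map_add, map_smul, map_smul]
  simp only [Finsupp.add_apply, Finsupp.smul_apply, smul_eq_mul]
  positivity

theorem geomRep_mul_simple (w : W) (i : B) :
    cs.geomRep (w * cs.simple i) (M.simpleRoot i) = -cs.geomRep w (M.simpleRoot i) := by
  rw [map_mul, LinearEquiv.mul_apply, geomRep_simple, M.rootReflection_simpleRoot_self, map_neg]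

theorem geomRep_simpleRoot_nonpos (hM : ∀ i j, M i j ≠ 0) (w : W) (i : B)
    (hw : cs.IsRightDescent w i) (b : B) : cs.geomRep w (M.simpleRoot i) b ≤ 0 := by
  have h := cs.geomRep_simpleRoot_nonneg hM (w * cs.simple i) i
    (cs.isRightDescent_iff_not_isRightDescent_mul.mp hw) b
  rw [geomRep_mul_simple, Finsupp.neg_apply] at h
  linarith

theorem isRightDescent_iff_geomRep_nonpos (hM : ∀ i j, M i j ≠ 0) (w : W) (i : B) :
    cs.IsRightDescent w i ↔ ∀ b, cs.geomRep w (M.simpleRoot i) b ≤ 0 := by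
  refine ⟨cs.geomRep_simpleRoot_nonpos hM w i, fun h => ?_⟩
  by_contra hw
  have h0 : cs.geomRep w (M.simpleRoot i) = 0 := by
    ext b
    exact le_antisymm (h b) (cs.geomRep_simpleRoot_nonneg hM w i hw b)
  rw [LinearEquiv.map_eq_zero_iff] at h0
  simp [CoxeterMatrix.simpleRoot] at h0

/-- `des w` is the number of right descents of `w`. -/
theorem des_eq_ncard (hM : ∀ i j, M i j ≠ 0) (w : W) :
    cs.des w = {i | cs.IsRightDescent w i}.ncard := by
  have hinj : Function.Injective M.simpleRoot := fun i j h =>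
    Finsupp.single_left_injective one_ne_zero h
  rw [des, ← Set.ncard_image_of_injective _ hinj]
  congr 1
  ext β
  simp only [descents, negativeRoots, CoxeterMatrix.simpleRoots, roots, Set.mem_ofPred_eq,
    Set.mem_range, Set.mem_image]
  constructor
  · rintro ⟨⟨i, rfl⟩, -, h⟩
    exact ⟨i, (cs.isRightDescent_iff_geomRep_nonpos hM w i).mpr h, rfl⟩
  · rintro ⟨i, hi, rfl⟩
    exact ⟨⟨i, rfl⟩, ⟨w, _, ⟨i, rfl⟩, rfl⟩, (cs.isRightDescent_iff_geomRep_nonpos hM w i).mp hi⟩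

end CoxeterSystem

/-! ### Dihedral parabolic subgroups and their cosets -/

namespace CoxeterSystem

variable {B : Type*} {M : CoxeterMatrix B} {W : Type*} [Group W] (cs : CoxeterSystem M W)

/-- An element with no descents among `i` and `j` acquires one when multiplied by a nontrivial
element of the dihedral parabolic subgroup generated by `s_i` and `s_j`. -/
theorem isRightDescent_mul_alternatingProd_of_le (hM : ∀ i j, M i j ≠ 0) {i j : B} (hij : i ≠ j)
    {d : W} (hi : ¬ cs.IsRightDescent d i) (hj : ¬ cs.IsRightDescent d j) {k : ℕ} (hk : 0 < k)
    (hkM : k ≤ M i j) : cs.IsRightDescent (d * cs.alternatingProd i j k) j := by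
  obtain ⟨k, rfl⟩ := Nat.exists_eq_add_of_le' hk
  obtain ⟨x, y, hx, hy, hxy⟩ := cs.exists_geomRep_alternatingProd hij.symm (hM j i) (k := k)
    (by rw [M.symmetric]; omega)
  rw [cs.isRightDescent_iff_geomRep_nonpos hM, alternatingProd_succ, ← mul_assoc,
    geomRep_mul_simple, map_mul, LinearEquiv.mul_apply, hxy]
  intro b
  have h1 := cs.geomRep_simpleRoot_nonneg hM d i hi b
  have h2 := cs.geomRep_simpleRoot_nonneg hM d j hj b
  simp only [map_add, map_smul, Finsupp.neg_apply, Finsupp.add_apply, Finsupp.smul_apply,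
    smul_eq_mul, Left.neg_nonpos_iff]
  positivity

theorem isRightDescent_mul_alternatingProd (hM : ∀ i j, M i j ≠ 0) {i j : B} (hij : i ≠ j)
    {d : W} (hi : ¬ cs.IsRightDescent d i) (hj : ¬ cs.IsRightDescent d j) {k : ℕ} (hk : 0 < k)
    (hkM : k < 2 * M i j) : cs.IsRightDescent (d * cs.alternatingProd i j k) i ∨
      cs.IsRightDescent (d * cs.alternatingProd i j k) j := by
  rcases le_or_gt k (M i j) with h | h
  · exact .inr (cs.isRightDescent_mul_alternatingProd_of_le hM hij hi hj hk h)
  · rw [cs.alternatingProd_eq_sub i j hkM.le]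
    exact .inl (cs.isRightDescent_mul_alternatingProd_of_le hM hij.symm hj hi (by omega)
      (by rw [M.symmetric j i]; omega))

theorem alternatingProd_ne_one (hM : ∀ i j, M i j ≠ 0) {i j : B} (hij : i ≠ j) {k : ℕ}
    (hk : 0 < k) (hkM : k < 2 * M i j) : cs.alternatingProd i j k ≠ 1 := by
  intro h
  have := cs.isRightDescent_mul_alternatingProd hM hij (cs.not_isRightDescent_one i)
    (cs.not_isRightDescent_one j) hk hkM
  rw [h, mul_one] at this
  exact this.elim (cs.not_isRightDescent_one i) (cs.not_isRightDescent_one j)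

theorem alternatingProd_injOn (hM : ∀ i j, M i j ≠ 0) {i j : B} (hij : i ≠ j) :
    Set.InjOn (cs.alternatingProd i j) (Set.Iio (2 * M i j)) := by
  have key : ∀ k l, k < l → l < 2 * M i j →
      cs.alternatingProd i j k ≠ cs.alternatingProd i j l := by
    intro k l hkl hl h
    obtain ⟨d, rfl⟩ := Nat.exists_eq_add_of_lt hkl
    -- Cancelling the common tail leaves a nonempty alternating word of length below `2m` equal to
    -- 1.
    rw [show k + d + 1 = (d + 1) + k by ring, alternatingProd_add, right_eq_mul] at h
    split_ifs at h
    · exact cs.alternatingProd_ne_one hM hij (by omega) (by omega) h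
    · exact cs.alternatingProd_ne_one hM hij.symm (by omega) (by rw [M.symmetric j i]; omega) h
  intro k hk l hl h
  rcases lt_trichotomy k l with hlt | rfl | hlt
  · exact absurd h (key k l hlt hl)
  · rfl
  · exact absurd h.symm (key l k hlt hk)

/-- The order of `s_i s_j` is `M i j`. -/
theorem orderOf_simple_mul_simple (hM : ∀ i j, M i j ≠ 0) (i j : B) :
    orderOf (cs.simple i * cs.simple j) = M i j := by
  rcases eq_or_ne i j with rfl | hij
  · simp
  rw [orderOf_eq_iff (Nat.pos_of_ne_zero (hM i j))]
  refine ⟨cs.simple_mul_simple_pow i j, fun k hk hk0 h => ?_⟩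
  apply cs.alternatingProd_ne_one hM hij (k := 2 * k) (by omega) (by omega)
  rw [alternatingProd, prod_alternatingWord_eq_mul_pow]
  simp [h]

/-- The dihedral parabolic subgroup generated by `s_i` and `s_j`. -/
def dihedral (i j : B) : Subgroup W := Subgroup.closure {cs.simple i, cs.simple j}

/-- A generator on the left either extends an alternating word or cancels its first letter, wrapping
around at length `2m`. -/
theorem coe_dihedral (hM : ∀ i j, M i j ≠ 0) (i j : B) :
    (cs.dihedral i j : Set W) = cs.alternatingProd i j '' Set.Iio (2 * M i j) := by
  have hM0 := hM i j
  have h2M : cs.alternatingProd i j (2 * M i j) = 1 := by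
    rw [cs.alternatingProd_eq_sub i j le_rfl]; simp
  have step : ∀ k < 2 * M i j, ∀ t, t = i ∨ t = j →
      ∃ l < 2 * M i j, cs.alternatingProd i j l = cs.simple t * cs.alternatingProd i j k := by
    intro k hk t ht
    by_cases h : t = if Even k then j else i
    · subst h
      rcases Nat.lt_or_ge (k + 1) (2 * M i j) with h1 | h1
      · exact ⟨k + 1, h1, cs.alternatingProd_succ' i j k⟩
      · refine ⟨0, by omega, ?_⟩
        rw [← alternatingProd_succ', show k + 1 = 2 * M i j by omega, h2M, alternatingProd_zero]
    · have h' : t = if Even k then i else j := by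
        rcases ht with rfl | rfl <;> split_ifs at h ⊢ <;> simp_all
      rcases k with _ | k
      · have ht : t = i := by simpa using h'
        subst ht
        refine ⟨2 * M t j - 1, by omega, ?_⟩
        rw [cs.alternatingProd_eq_sub t j (by omega),
          show 2 * M t j - (2 * M t j - 1) = 0 + 1 by omega, alternatingProd_succ]
        simp
      · refine ⟨k, by omega, ?_⟩
        rw [alternatingProd_succ', h']
        by_cases hk : Even k <;> simp [hk, Nat.even_add_one]
  ext p
  simp only [SetLike.mem_coe, Set.mem_image, Set.mem_Iio]
  constructor
  · intro hp
    unfold dihedral at hp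
    induction hp using Subgroup.closure_induction_left with
    | one => exact ⟨0, by omega, by simp⟩
    | mul_left x hx y hy ih =>
      obtain ⟨k, hk, rfl⟩ := ih
      rcases hx with rfl | rfl
      · exact step k hk i (.inl rfl)
      · exact step k hk j (.inr rfl)
    | inv_mul_cancel x hx y hy ih =>
      obtain ⟨k, hk, rfl⟩ := ih
      rcases hx with rfl | rfl
      · rw [inv_simple]; exact step k hk i (.inl rfl)
      · rw [inv_simple]; exact step k hk j (.inr rfl)
  · rintro ⟨k, -, rfl⟩
    induction k with
    | zero => simp
    | succ k ih =>
      rw [alternatingProd_succ']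
      refine mul_mem (Subgroup.subset_closure ?_) ih
      split_ifs <;> simp

theorem card_dihedral (hM : ∀ i j, M i j ≠ 0) {i j : B} (hij : i ≠ j) :
    Nat.card (cs.dihedral i j) = 2 * M i j := by
  rw [← SetLike.coe_sort_coe, Nat.card_coe_set_eq, cs.coe_dihedral hM,
    (cs.alternatingProd_injOn hM hij).ncard_image, Set.ncard_Iio_nat]

/-- The elements with no descents among `i` and `j` represent the cosets of the dihedral
parabolic subgroup generated by `s_i` and `s_j`. -/
theorem isComplement_dihedral (hM : ∀ i j, M i j ≠ 0) {i j : B} (hij : i ≠ j) :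
    Subgroup.IsComplement {w | ¬ cs.IsRightDescent w i ∧ ¬ cs.IsRightDescent w j}
      (cs.dihedral i j : Set W) := by
  rw [Subgroup.isComplement_iff_existsUnique_inv_mul_mem]
  intro g
  have hex : ∃ d, (¬ cs.IsRightDescent d i ∧ ¬ cs.IsRightDescent d j) ∧
      d⁻¹ * g ∈ cs.dihedral i j := by
    -- A shortest element of the coset has no descent at `i` or `j`.
    obtain ⟨d, hd, hmin⟩ := (measure cs.length).wf.has_min {d | d⁻¹ * g ∈ cs.dihedral i j}
      ⟨g, by simp⟩
    have hstep : ∀ t, t = i ∨ t = j → ¬ cs.IsRightDescent d t := by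
      intro t ht hlt
      refine hmin (d * cs.simple t) ?_ hlt
      simp only [Set.mem_ofPred_eq, mul_inv_rev, inv_simple, mul_assoc]
      refine mul_mem (Subgroup.subset_closure ?_) hd
      rcases ht with rfl | rfl <;> simp
    exact ⟨d, ⟨hstep i (.inl rfl), hstep j (.inr rfl)⟩, hd⟩
  obtain ⟨d, hd, hdg⟩ := hex
  refine ⟨⟨d, hd⟩, hdg, ?_⟩
  rintro ⟨e, he⟩ heg
  simp only [SetLike.mem_coe] at heg
  have hp : d⁻¹ * e ∈ (cs.dihedral i j : Set W) := by
    have := mul_mem hdg (inv_mem heg)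
    simpa [mul_assoc] using this
  rw [cs.coe_dihedral hM] at hp
  obtain ⟨k, hk, hkp⟩ := hp
  have hed : e = d * cs.alternatingProd i j k := by rw [hkp]; simp
  rcases Nat.eq_zero_or_pos k with rfl | hk0
  · simpa using hed
  · have := cs.isRightDescent_mul_alternatingProd hM hij hd.1 hd.2 hk0 hk
    rw [← hed] at this
    exact absurd this (by simpa using he)

/-! ### Moments of the descent number -/

open Classical in
/-- The indicator of `i` being a right descent of `w`. -/
noncomputable def descentIndicator (w : W) (i : B) : ℝ := if cs.IsRightDescent w i then 1 else 0

theorem des_eq_sum [Fintype B] (hM : ∀ i j, M i j ≠ 0) (w : W) :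
    (cs.des w : ℝ) = ∑ i, cs.descentIndicator w i := by
  classical
  rw [cs.des_eq_ncard hM]
  simp only [descentIndicator, Finset.sum_boole]
  rw [← Set.ncard_coe_finset]
  simp

theorem sum_descentIndicator [Fintype W] (i : B) :
    ∑ w, cs.descentIndicator w i = Fintype.card W / 2 := by
  have h1 : ∑ w, cs.descentIndicator w i = ∑ w, (1 - cs.descentIndicator w i) := by
    rw [← Equiv.sum_comp (Equiv.mulRight (cs.simple i))]
    refine Finset.sum_congr rfl fun w _ => ?_
    simp only [descentIndicator, Equiv.coe_mulRight]
    by_cases h : cs.IsRightDescent w i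
    · simp [h, cs.isRightDescent_iff_not_isRightDescent_mul.mp h]
    · rw [cs.isRightDescent_iff_not_isRightDescent_mul, not_not] at h
      simp [h, cs.isRightDescent_iff_not_isRightDescent_mul (w := w)]
  rw [Finset.sum_sub_distrib] at h1
  simp at h1
  linarith

/-- Counting coset representatives gives the elements with neither descent; expanding `(1 - x)(1 -
y)` with means 1/2 turns this into the count with both. -/
theorem sum_descentIndicator_mul [Fintype W] (hM : ∀ i j, M i j ≠ 0) (i j : B) :
    ∑ w, cs.descentIndicator w i * cs.descentIndicator w j =
      Fintype.card W * (1 / (2 * M i j)) := by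
  rcases eq_or_ne i j with rfl | hij
  · have : ∀ w, cs.descentIndicator w i * cs.descentIndicator w i = cs.descentIndicator w i := by
      intro w; simp [descentIndicator]
    simp only [this, sum_descentIndicator, M.diagonal]
    push_cast; ring
  classical
  have h1 := (cs.isComplement_dihedral hM hij).card_mul_card
  rw [SetLike.coe_sort_coe, cs.card_dihedral hM hij, Nat.card_coe_set_eq,
    Nat.card_eq_fintype_card] at h1
  have h2 : ∑ w, (1 - cs.descentIndicator w i) * (1 - cs.descentIndicator w j) =
      ({w | ¬ cs.IsRightDescent w i ∧ ¬ cs.IsRightDescent w j} : Set W).ncard := by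
    rw [Set.ncard_eq_toFinset_card', Set.toFinset_ofPred, ← Finset.sum_boole]
    refine Finset.sum_congr rfl fun w _ => ?_
    by_cases hi : cs.IsRightDescent w i <;> by_cases hj : cs.IsRightDescent w j <;>
      simp [descentIndicator, hi, hj]
  have h3 : ∑ w, (1 - cs.descentIndicator w i) * (1 - cs.descentIndicator w j) =
      ∑ w, cs.descentIndicator w i * cs.descentIndicator w j := by
    have : ∀ w, (1 - cs.descentIndicator w i) * (1 - cs.descentIndicator w j) =
        1 - cs.descentIndicator w i - cs.descentIndicator w j
          + cs.descentIndicator w i * cs.descentIndicator w j := fun w => by ring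
    simp only [this, Finset.sum_add_distrib, Finset.sum_sub_distrib, sum_descentIndicator]
    simp
    ring
  rw [← h3, h2, ← h1]
  have := hM i j
  push_cast
  field_simp

theorem sum_des [Fintype B] [Fintype W] (hM : ∀ i j, M i j ≠ 0) :
    ∑ w, (cs.des w : ℝ) = Fintype.card W * (Fintype.card B / 2) := by
  simp only [cs.des_eq_sum hM]
  rw [Finset.sum_comm]
  simp only [sum_descentIndicator]
  simp
  ring

theorem sum_des_sq [Fintype B] [Fintype W] (hM : ∀ i j, M i j ≠ 0) :
    ∑ w, (cs.des w : ℝ) ^ 2 = Fintype.card W * ∑ i, ∑ j, (1 / (2 * M i j) : ℝ) := by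
  simp only [cs.des_eq_sum hM, sq, Finset.sum_mul_sum]
  rw [Finset.sum_comm, Finset.mul_sum]
  refine Finset.sum_congr rfl fun i _ => ?_
  rw [Finset.sum_comm, Finset.mul_sum]
  exact Finset.sum_congr rfl fun j _ => cs.sum_descentIndicator_mul hM i j

end CoxeterSystem

theorem integral_uniformOn_univ {Ω : Type*} [Fintype Ω] [Nonempty Ω] [MeasurableSpace Ω]
    [DiscreteMeasurableSpace Ω] (f : Ω → ℝ) :
    ∫ x, f x ∂(uniformOn (Set.univ : Set Ω)) = (∑ x, f x) / Fintype.card Ω := by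
  rw [integral_fintype .of_finite, Finset.sum_div]
  refine Finset.sum_congr rfl fun x _ => ?_
  rw [Measure.real, uniformOn_univ, Measure.count_singleton]
  simp
  ring

/-- The sum of `1 / (2 m(i, j))` over all pairs `(i, j)`, for a diagram which is a tree with at
most one edge whose label is not `3`. -/
theorem CoxeterMatrix.sum_one_div_of_posDef {B : Type*} [Fintype B] {M : CoxeterMatrix B}
    (hirr : M.IsIrreducible) (hpos : ∀ v, v ≠ 0 → 0 < M.rootForm v v) {a b : B}
    (hab : M.diagram.Adj a b) (hmax : ∀ i j, M i j ≤ M a b) :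
    ∑ i, ∑ j, (1 / (2 * M i j) : ℝ) =
      (Fintype.card B : ℝ) ^ 2 / 4 + ((Fintype.card B : ℝ) - 2) / 12 + 1 / M a b := by
  classical
  have hM := CoxeterMatrix.ne_zero_of_posDef hpos
  have hconn : M.diagram.Connected := hirr
  have := hconn.nonempty
  -- Connectedness gives at least `n - 1` edges and positivity fewer than `n`.
  have hdeg : ∑ i, M.diagram.degree i = 2 * (Fintype.card B - 1) := by
    have h1 := CoxeterMatrix.sum_adj_lt_of_posDef hpos
    have h2 := hconn.card_vert_le_card_edgeSet_add_one
    rw [Nat.card_eq_fintype_card, Nat.card_eq_fintype_card, ← SimpleGraph.edgeFinset_card] at h2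
    have h3 := M.diagram.sum_degrees_eq_twice_card_edges
    omega
  have hdeg' : (∑ i, M.diagram.degree i : ℝ) = 2 * (Fintype.card B - 1) := by
    have h1 : 1 ≤ Fintype.card B := Fintype.card_pos
    have h2 := congrArg (Nat.cast (R := ℝ)) hdeg
    push_cast [h1] at h2
    exact h2
  have hlab : ∀ i j, M.diagram.Adj i j → s(i, j) ≠ s(a, b) → M i j = 3 := by
    intro i j hij hne
    by_contra h3
    have h0 := hM i j
    have h1 := M.off_diagonal i j hij.1
    have h2 := hij.2
    have h4 := hmax i j
    exact hne (CoxeterMatrix.edge_unique_of_posDef hirr hpos hij h3 hab (by omega))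
  -- Baseline 1/4 for label 2, corrected to 1/2 on the diagonal, to 1/6 on edges, and to `1/(2m)` on
  -- both orientations of the maximal edge.
  have hterm : ∀ i j, (1 / (2 * M i j) : ℝ) = 1 / 4 + (1 / 4) * (if i = j then 1 else 0)
      - (1 / 12) * (if M.diagram.Adj i j then 1 else 0)
      + (1 / (2 * M a b) - 1 / 6) * ((if a = i then if b = j then 1 else 0 else 0)
        + (if b = i then if a = j then 1 else 0 else 0)) := by
    intro i j
    have hne := hab.ne
    by_cases hs : s(i, j) = s(a, b)
    · rw [Sym2.eq_iff] at hs
      rcases hs with ⟨rfl, rfl⟩ | ⟨rfl, rfl⟩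
      · simp [hne, hne.symm, hab]; ring
      · simp [hne, hne.symm, hab.symm, M.symmetric i j]; ring
    · have hz : ((if a = i then if b = j then (1 : ℝ) else 0 else 0)
          + (if b = i then if a = j then 1 else 0 else 0)) = 0 := by
        rw [Sym2.eq_iff] at hs
        split_ifs <;> simp_all
      rw [hz]
      by_cases hadj : M.diagram.Adj i j
      · rw [hlab i j hadj hs, if_pos hadj, if_neg hadj.ne]; norm_num
      · rw [if_neg hadj]
        rcases eq_or_ne i j with rfl | hij
        · simp; norm_num
        · have : M i j = 2 := by
            by_contra h; exact hadj ⟨hij, h⟩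
          rw [if_neg hij, this]; norm_num
  have hdegi : ∀ i, (∑ j, if M.diagram.Adj i j then (1 : ℝ) else 0) = M.diagram.degree i := by
    intro i
    rw [Finset.sum_boole, ← SimpleGraph.card_neighborFinset_eq_degree,
      SimpleGraph.neighborFinset_eq_filter]
  have hpair : ∀ x y : B,
      ∑ i, ∑ j, (if x = i then if y = j then (1 : ℝ) else 0 else 0) = 1 := by
    intro x y
    rw [Finset.sum_eq_single x (fun i _ hi => by simp [hi.symm]) (by simp)]
    simp
  rw [Finset.sum_congr rfl fun i _ => Finset.sum_congr rfl fun j _ => hterm i j]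
  simp only [Finset.sum_add_distrib, Finset.sum_sub_distrib, ← Finset.mul_sum, hdegi,
    hdeg', hpair, Finset.sum_ite_eq, Finset.mem_univ, if_true, Finset.sum_const, Finset.card_univ,
    nsmul_eq_mul]
  ring

theorem theorem4p1 {B W : Type*} [Fintype B] [Group W] [Finite W]
    [MeasurableSpace W] [DiscreteMeasurableSpace W]
    (M : CoxeterMatrix B) (cs : CoxeterSystem M W)
    (hirr : M.IsIrreducible) (hrank : 2 ≤ Fintype.card B) :
    (∫ w, (cs.des w : ℝ) ∂(uniformOn (Set.univ : Set W))) = (Fintype.card B : ℝ) / 2 ∧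
    variance (fun w => (cs.des w : ℝ)) (uniformOn (Set.univ : Set W)) =
      ((Fintype.card B : ℝ) - 2) / 12 + 1 / (cs.mMax : ℝ) := by
  classical
  cases nonempty_fintype W
  have hpos := cs.rootForm_pos_of_finite hirr
  have hM := CoxeterMatrix.ne_zero_of_posDef hpos
  have hconn : M.diagram.Connected := hirr
  have hcard : (Fintype.card W : ℝ) ≠ 0 := by exact_mod_cast Fintype.card_ne_zero
  have hmean : (∫ w, (cs.des w : ℝ) ∂(uniformOn (Set.univ : Set W))) =
      (Fintype.card B : ℝ) / 2 := by
    rw [integral_uniformOn_univ, cs.sum_des hM, mul_div_cancel_left₀ _ hcard]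
  refine ⟨hmean, ?_⟩
  have : Nonempty B := hconn.nonempty
  obtain ⟨⟨a, b⟩, -, hab⟩ := Finset.exists_mem_eq_sup (Finset.univ : Finset (B × B))
    Finset.univ_nonempty fun p => orderOf (cs.simple p.1 * cs.simple p.2)
  have hmMax : cs.mMax = M a b := hab.trans (cs.orderOf_simple_mul_simple hM a b)
  have hmax : ∀ i j, M i j ≤ M a b := by
    intro i j
    rw [← hmMax, ← cs.orderOf_simple_mul_simple hM i j]
    exact Finset.le_sup (f := fun p : B × B => orderOf (cs.simple p.1 * cs.simple p.2))
      (Finset.mem_univ (i, j))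
  -- Rank at least 2 and connectedness supply a label at least 3, so the maximum is attained on an
  -- edge.
  have hadj : M.diagram.Adj a b := by
    have : Nontrivial B := Fintype.one_lt_card_iff_nontrivial.mp hrank
    obtain ⟨i⟩ := ‹Nonempty B›
    obtain ⟨j, hij⟩ := hconn.preconnected.exists_adj_of_nontrivial i
    have h1 := M.off_diagonal i j hij.1
    have h2 := hij.2
    have h3 := hM i j
    have h4 := hmax i j
    refine ⟨?_, by omega⟩
    rintro rfl
    rw [M.diagonal] at h4
    omega
  rw [variance_eq_sub (MemLp.of_discrete), hmean, integral_uniformOn_univ, hmMax]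
  simp only [Pi.pow_apply]
  rw [cs.sum_des_sq hM, mul_div_cancel_left₀ _ hcard,
    CoxeterMatrix.sum_one_div_of_posDef hirr hpos hadj hmax]
  ring
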